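/- Let $q \ge 6$ be a prime power, let $\overline{\mathbb{F}}_q$ be an algebraic closure of $\mathbb{F}_q$, and let $E$ be an elliptic curve defined over $\mathbb{F}_q$, with function field $\mathbb{F}_q(E)$ and identity $\mathcal{O}$. A place $R$ of $\mathbb{F}_q(E)$ is the maximal ideal of a discrete valuation ring $\mathcal{O}_R$ with $\mathbb{F}_q \subseteq \mathcal{O}_R \subset \mathbb{F}_q(E)$ and fraction field $\mathbb{F}_q(E)$; its degree is $[\mathcal{O}_R/R : \mathbb{F}_q]$. Such a place corresponds to a Galois orbit of points of $E(\overline{\mathbb{F}}_q)$, namely the set of points $Q$ such that $\mathcal{O}_R$ is the ring of those functions in $\mathbb{F}_q(E)$ that are regular at $Q$; write $[R] = \sum_Q [Q]$ for the divisor given by this orbit. For a divisor $G = \sum_Q n_Q [Q]$ on $E(\overline{\mathbb{F}}_q)$ put $\operatorname{sum}(G) = \sum_Q n_Q Q \in E(\overline{\mathbb{F}}_q)$, the sum being taken in the group law of $E$. Then there exists a place $R$ of $\mathbb{F}_q(E)$ of degree $3$ such that $\operatorname{sum}([R]) = \mathcal{O}$. -/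

import Mathlib

open Polynomial
open scoped Polynomial.Bivariate WeierstrassCurve

namespace EllipticPlace

section LocalRing

variable {K : Type*} [Field K] {L : Type*} [Field L] [Algebra K L]

/-- The rational function on `E` given by a polynomial `p(X, Y)` with coefficients in `K`. -/
noncomputable def polyFun (E : WeierstrassCurve K) (p : K[X][Y]) : E.toAffine.FunctionField :=
  algebraMap E.toAffine.CoordinateRing E.toAffine.FunctionField
    (WeierstrassCurve.Affine.CoordinateRing.mk E.toAffine p)

/-- `IsRegularAt E Q f`: the rational function `f ∈ K(E)` is regular at the geometric point `Q`.
At an affine point `(x, y)` this says that `f = a / b` with polynomials `a`, `b` in the coordinates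
and `b (x, y) ≠ 0`. At the point at infinity it says that `f = a / b` with `a`, `b` in `K[E]`,
`b ≠ 0`, where the pole order of `a` at infinity is at most that of `b`; the pole order at infinity
of an element of `K[E]` is the degree of its norm to `K[X]`. -/
def IsRegularAt (E : WeierstrassCurve K) :
    (E⁄L).toAffine.Point → E.toAffine.FunctionField → Prop
  | .zero, f => ∃ a b : E.toAffine.CoordinateRing, b ≠ 0 ∧
      (Algebra.norm K[X] a).degree ≤ (Algebra.norm K[X] b).degree ∧
      f = algebraMap _ E.toAffine.FunctionField a / algebraMap _ E.toAffine.FunctionField b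
  | .some x y _, f => ∃ a b : K[X][Y], aevalAeval x y b ≠ 0 ∧ f = polyFun E a / polyFun E b

end LocalRing

/-- A place of a function field `F` over `K`, given by its valuation ring: a discrete valuation ring
with fraction field `F` that contains the constants. The place itself, as a set, is the maximal
ideal of this ring. -/
structure Place (K F : Type*) [Field K] [Field F] [Algebra K F] where
  /-- The valuation ring of the place. -/
  valRing : ValuationSubring F
  algebraMap_mem : ∀ c : K, algebraMap K F c ∈ valRing
  isDVR : IsDiscreteValuationRing valRing

namespace Place

section Degree

variable {K F : Type*} [Field K] [Field F] [Algebra K F]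

noncomputable instance (R : Place K F) : Algebra K R.valRing :=
  ((algebraMap K F).codRestrict R.valRing R.algebraMap_mem).toAlgebra

/-- The degree of a place: the degree over `K` of its residue field. -/
noncomputable def degree (R : Place K F) : ℕ :=
  Module.finrank K (IsLocalRing.ResidueField R.valRing)

end Degree

variable {K : Type*} [Field K] {E : WeierstrassCurve K}

/-- The set of geometric points corresponding to a place: those points `Q` such that the valuation
ring of the place is the ring of the functions in `K(E)` that are regular at `Q`. -/
def points (R : Place K E.toAffine.FunctionField) (L : Type*) [Field L] [Algebra K L] : Set (E⁄L).toAffine.Point :=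
  {Q | ∀ f : E.toAffine.FunctionField, f ∈ R.valRing ↔ IsRegularAt E Q f}

end Place

section Finiteness

variable {K : Type*} [Field K] {E : WeierstrassCurve K} {L : Type*} [Field L] [Algebra K L]

lemma aevalAeval_eq_zero_of_mk {x y : L} (h : (E⁄L).toAffine.Equation x y) {p : K[X][Y]}
    (hp : WeierstrassCurve.Affine.CoordinateRing.mk E.toAffine p = 0) : aevalAeval x y p = 0 := by
  have hE : aevalAeval x y E.toAffine.polynomial = 0 := by
    have h1 : y ^ 2 + algebraMap K L E.a₁ * x * y + algebraMap K L E.a₃ * y -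
        (x ^ 3 + algebraMap K L E.a₂ * x ^ 2 + algebraMap K L E.a₄ * x + algebraMap K L E.a₆) = 0 :=
      (WeierstrassCurve.Affine.equation_iff' x y).1 h
    rw [← h1]
    simp [WeierstrassCurve.Affine.polynomial, add_mul]
    exact (add_assoc _ _ _).symm
  obtain ⟨q, rfl⟩ := AdjoinRoot.mk_eq_zero.1 hp
  rw [map_mul, hE, zero_mul]

lemma isRegularAt_inv_iff {x y : L} (h : (E⁄L).toAffine.Nonsingular x y) {p : K[X][Y]}
    (hp : polyFun E p ≠ 0) :
    IsRegularAt E (.some x y h) (polyFun E p)⁻¹ ↔ aevalAeval x y p ≠ 0 := by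
  constructor
  · rintro ⟨a, b, hb, hab⟩ h0
    have hb' : polyFun E b ≠ 0 := by
      intro hb0
      refine hb (aevalAeval_eq_zero_of_mk h.1 ?_)
      exact (map_eq_zero_iff _ (IsFractionRing.injective _ E.toAffine.FunctionField)).1 hb0
    rw [eq_div_iff hb', inv_mul_eq_iff_eq_mul₀ hp] at hab
    have h1 : WeierstrassCurve.Affine.CoordinateRing.mk E.toAffine (b - p * a) = 0 := by
      rw [map_sub, map_mul, sub_eq_zero]
      apply IsFractionRing.injective _ E.toAffine.FunctionField
      rw [map_mul]
      exact hab
    have h2 := aevalAeval_eq_zero_of_mk h.1 h1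
    rw [map_sub, map_mul, h0, zero_mul, sub_zero] at h2
    exact hb h2
  · intro h0
    exact ⟨1, p, h0, by simp [polyFun]⟩

lemma Place.finite_points (R : Place K E.toAffine.FunctionField) [IsAlgClosure K L] : (R.points L).Finite := by
  classical
  have : Algebra.IsAlgebraic K L := IsAlgClosure.isAlgebraic
  by_cases hne : ∃ x y h, (.some x y h : (E⁄L).toAffine.Point) ∈ R.points L
  · obtain ⟨x₀, y₀, h₀, hQ₀⟩ := hne
    have key : ∀ p : K[X][Y], aevalAeval x₀ y₀ p = 0 →
        ∀ x y h, (.some x y h : (E⁄L).toAffine.Point) ∈ R.points L → aevalAeval x y p = 0 := by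
      intro p hp x y h hQ
      by_cases hz : polyFun E p = 0
      · refine aevalAeval_eq_zero_of_mk h.1 ?_
        exact (map_eq_zero_iff _ (IsFractionRing.injective _ E.toAffine.FunctionField)).1 hz
      · by_contra hc
        exact (isRegularAt_inv_iff h₀ hz).1 ((hQ₀ _).1 ((hQ _).2 ((isRegularAt_inv_iff h hz).2 hc)))
          hp
    let S : Set (L × L) := ((minpoly K x₀).rootSet L) ×ˢ ((minpoly K y₀).rootSet L)
    have hS : S.Finite := (Polynomial.rootSet_finite _ _).prod (Polynomial.rootSet_finite _ _)
    let g : (E⁄L).toAffine.Point → Option (L × L)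
      | .zero => none
      | .some x y _ => some (x, y)
    have hg : Function.Injective g := by
      rintro (_ | ⟨x, y, h⟩) (_ | ⟨x', y', h'⟩) he <;> simp_all [g]
    refine Set.Finite.of_finite_image (f := g) (((hS.image some).insert none).subset ?_)
      hg.injOn
    rintro _ ⟨(_ | ⟨x, y, h⟩), hQ, rfl⟩
    · exact Or.inl rfl
    · refine Or.inr ⟨(x, y), ⟨?_, ?_⟩, rfl⟩
      · rw [Polynomial.mem_rootSet]
        refine ⟨minpoly.ne_zero (Algebra.IsAlgebraic.isAlgebraic x₀).isIntegral, ?_⟩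
        simpa using key (C (minpoly K x₀)) (by simp) x y h hQ
      · rw [Polynomial.mem_rootSet]
        refine ⟨minpoly.ne_zero (Algebra.IsAlgebraic.isAlgebraic y₀).isIntegral, ?_⟩
        have hY : ∀ u v : L,
            aevalAeval u v (aeval (Y : K[X][Y]) (minpoly K y₀)) = aeval v (minpoly K y₀) := by
          intro u v
          rw [← aeval_algHom_apply, aevalAeval_Y]
        rw [← hY x y]
        exact key _ (by rw [hY]; exact minpoly.aeval K y₀) x y h hQ
  · refine (Set.finite_singleton (0 : (E⁄L).toAffine.Point)).subset ?_
    rintro (_ | ⟨x, y, h⟩) hQ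
    · rfl
    · exact absurd ⟨x, y, h, hQ⟩ hne

end Finiteness

section Divisors

variable {K : Type*} [Field K] (E : WeierstrassCurve K) (L : Type*) [Field L] [Algebra K L]

/-- Divisors on `E`: the free abelian group on the set of geometric points. -/
abbrev Divisor : Type _ := (E⁄L).toAffine.Point →₀ ℤ

variable {E L}

/-- The divisor `[R]` of a place `R`: the sum of the geometric points corresponding to it. -/
noncomputable def Place.divisor (R : Place K E.toAffine.FunctionField) (L : Type*) [Field L] [Algebra K L]
    [IsAlgClosure K L] : Divisor E L :=
  ∑ Q ∈ (R.finite_points (L := L)).toFinset, Finsupp.single Q 1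

open scoped Classical in
/-- The sum map `∑ n_Q [Q] ↦ ∑ n_Q Q` from divisors to the group of geometric points. -/
noncomputable def Divisor.sum (D : Divisor E L) : (E⁄L).toAffine.Point :=
  Finsupp.sum D fun Q n => n • Q

end Divisors

end EllipticPlace

/-! A line `Y = aX + b` over `K` that meets `E` in no `K`-rational point cuts it in a cubic without
roots in `K`, hence irreducible. Its three roots are conjugate and distinct, so the three
intersection points form one Galois orbit, that is, a place of degree 3; being collinear, they sum
to the identity. Such a line exists by a second-moment count over the `q ^ 2` non-vertical lines
(`exists_line_disjoint`), which uses only how lines meet a cubic, with no estimate for the number of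
points of `E`. The place is the localization of the coordinate ring at the ideal generated by `Y -
aX - b` (`exists_place_of_irreducible`). -/

/-! ### Counting incidences of points and lines -/

open Finset in
/-- In a finite plane with at least five elements per line, a point set that meets every vertical
line in at most two points and every other line in at most three misses some non-vertical line. -/
theorem exists_line_disjoint {K : Type*} [Field K] [Fintype K] [DecidableEq K]
    (hq : 5 ≤ Fintype.card K) (S : Finset (K × K))
    (hv : ∀ x, #{P ∈ S | P.1 = x} ≤ 2) (hl : ∀ a b, #{P ∈ S | P.2 = a * P.1 + b} ≤ 3) :
    ∃ a b, ∀ P ∈ S, P.2 ≠ a * P.1 + b := by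
  by_contra! hcon
  -- A pair `l` encodes the line of slope `l.1` and intercept `l.2`.
  let on (P l : K × K) : ℤ := if P.2 = l.1 * P.1 + l.2 then 1 else 0
  let k (l : K × K) : ℤ := ∑ P ∈ S, on P l
  have hk : ∀ l, k l = #{P ∈ S | P.2 = l.1 * P.1 + l.2} := fun l => by simp [k, on]
  have hk1 : ∀ l, 1 ≤ k l := fun l => by
    obtain ⟨P, hP, h⟩ := hcon l.1 l.2
    rw [hk]
    exact_mod_cast card_pos.2 ⟨P, mem_filter.2 ⟨hP, h⟩⟩
  have hk3 : ∀ l, k l ≤ 3 := fun l => by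
    rw [hk]; exact_mod_cast hl l.1 l.2
  have hone : ∀ P : K × K, ∑ l, on P l = Fintype.card K := fun P => by
    rw [Fintype.sum_prod_type]
    have : ∀ a : K, ∑ b, on P (a, b) = 1 := fun a => by
      rw [Fintype.sum_eq_single (P.2 - a * P.1)]
      · simp [on]
      · intro b hb
        refine if_neg fun h => hb ?_
        linear_combination -h
    simp [this]
  have htwo : ∀ P Q : K × K, P.1 ≠ Q.1 → 1 ≤ ∑ l, on P l * on Q l := fun P Q h => by
    have h' : P.1 - Q.1 ≠ 0 := sub_ne_zero.2 h
    let a := (P.2 - Q.2) / (P.1 - Q.1)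
    have ha : a * (P.1 - Q.1) = P.2 - Q.2 := div_mul_cancel₀ _ h'
    have h1 : on P (a, P.2 - a * P.1) * on Q (a, P.2 - a * P.1) = 1 := by
      have : Q.2 = a * Q.1 + (P.2 - a * P.1) := by linear_combination ha
      simp only [on]
      rw [if_pos (by ring), if_pos this, one_mul]
    rw [← h1]
    refine single_le_sum (f := fun l => on P l * on Q l) (fun l _ => ?_) (mem_univ _)
    simp only [on]; split_ifs <;> simp
  have hsum : ∑ l, k l = #S * Fintype.card K := by
    simp only [k]
    rw [sum_comm]
    simp [hone]
  have hrow : ∀ P ∈ S, (Fintype.card K : ℤ) + (#S - 2) ≤ ∑ Q ∈ S, ∑ l, on P l * on Q l := by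
    intro P hP
    -- The term `Q = P` contributes `q`. At most two points of `S`, counting `P` itself, share the
    -- abscissa of `P`, so at least `#S - 2` others are joined to `P` by a non-vertical line.
    rw [← sum_filter_add_sum_filter_not S (fun Q => Q.1 = P.1)]
    refine add_le_add ?_ ?_
    · rw [← hone P]
      have : ∑ l, on P l = ∑ l, on P l * on P l :=
        sum_congr rfl fun l _ => by simp only [on]; split_ifs <;> simp
      rw [this]
      refine single_le_sum (f := fun Q => ∑ l, on P l * on Q l)
        (fun Q _ => sum_nonneg fun l _ => ?_) (mem_filter.2 ⟨hP, rfl⟩)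
      simp only [on]; split_ifs <;> simp
    · have hc : #S = #{Q ∈ S | Q.1 = P.1} + #{Q ∈ S | ¬ Q.1 = P.1} :=
        (card_filter_add_card_filter_not _).symm
      have h2 := hv P.1
      calc (#S - 2 : ℤ) ≤ #{Q ∈ S | ¬ Q.1 = P.1} := by omega
        _ = ∑ Q ∈ S with ¬ Q.1 = P.1, (1 : ℤ) := by simp
        _ ≤ _ := sum_le_sum fun Q hQ => htwo P Q (Ne.symm (mem_filter.1 hQ).2)
  have hsq : ∑ l, k l ^ 2 = ∑ P ∈ S, ∑ Q ∈ S, ∑ l, on P l * on Q l := by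
    simp only [k, sq, sum_mul_sum]
    rw [sum_comm]
    exact sum_congr rfl fun P _ => sum_comm
  have hsq' : (#S : ℤ) * (Fintype.card K + (#S - 2)) ≤ ∑ l, k l ^ 2 := by
    rw [hsq, ← nsmul_eq_mul]
    exact card_nsmul_le_sum _ _ _ hrow
  -- This is `(k - 1) * (3 - k) ≥ 0` summed over all lines.
  have hpt : ∑ l : K × K, (3 : ℤ) ≤ ∑ l, (4 * k l - k l ^ 2) :=
    sum_le_sum fun l _ => by nlinarith [hk1 l, hk3 l]
  rw [sum_sub_distrib, ← mul_sum, hsum] at hpt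
  simp only [sum_const, card_univ, Fintype.card_prod, nsmul_eq_mul, Nat.cast_mul] at hpt
  have hq' : (5 : ℤ) ≤ Fintype.card K := by exact_mod_cast hq
  -- With `n = #S` the bounds give `n² - (3q + 2)n + 3q² ≤ 0`. Four times the left side is `(2n - 3q
  -- - 2)² + 3q² - 12q - 4`, which is positive for `q ≥ 5`.
  nlinarith [sq_nonneg (2 * (#S : ℤ) - 3 * Fintype.card K - 2)]

/-! ### Places from principal maximal ideals -/

namespace EllipticPlace

theorem Place.degree_eq_finrank_of_ringEquiv {K F B : Type*} [Field K] [Field F] [Algebra K F]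
    [CommRing B] [Algebra K B] (R : Place K F) (e : B ≃+* IsLocalRing.ResidueField R.valRing)
    (he : ∀ c, e (algebraMap K B c) =
      IsLocalRing.residue R.valRing ⟨algebraMap K F c, R.algebraMap_mem c⟩) :
    R.degree = Module.finrank K B :=
  (LinearEquiv.finrank_eq (AlgEquiv.ofRingEquiv (f := e) he).toLinearEquiv).symm

/-- The place of the fraction field of a Noetherian domain at a nonzero principal maximal ideal. -/
theorem Place.exists_of_isPrincipal_maximal {K A F : Type*} [Field K] [CommRing A] [IsDomain A]
    [IsNoetherianRing A] [Algebra K A] [Field F] [Algebra A F] [IsFractionRing A F] [Algebra K F]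
    [IsScalarTower K A F] (m : Ideal A) [hm : m.IsMaximal] (hp : m.IsPrincipal) (h0 : m ≠ ⊥) :
    ∃ R : Place K F, R.degree = Module.finrank K (A ⧸ m) ∧
      ∀ f, f ∈ R.valRing ↔ ∃ a s : A, s ∉ m ∧ f = algebraMap A F a / algebraMap A F s := by
  let S : Subalgebra A F :=
    Localization.subalgebra.ofField F m.primeCompl m.primeCompl_le_nonZeroDivisors
  have hS : ∀ f, f ∈ S ↔ ∃ a s : A, s ∉ m ∧ f = algebraMap A F a / algebraMap A F s := by
    intro f
    simp only [div_eq_mul_inv]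
    exact ⟨fun ⟨a, s, hs, h⟩ => ⟨a, s, hs, h⟩, fun ⟨a, s, hs, h⟩ => ⟨a, s, hs, h⟩⟩
  have hloc : IsLocalization.AtPrime S m := Localization.subalgebra.isLocalization_ofField F _ _
  have hlocal : IsLocalRing S := IsLocalization.AtPrime.isLocalRing S m
  have hnoeth : IsNoetherianRing S := IsLocalization.isNoetherianRing m.primeCompl S inferInstance
  have hmax : IsLocalRing.maximalIdeal S = m.map (algebraMap A S) :=
    (IsLocalization.AtPrime.map_eq_maximalIdeal m S).symm
  have hfield : ¬ IsField S := by
    rw [IsLocalRing.isField_iff_maximalIdeal_eq, hmax,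
      Ideal.map_eq_bot_iff_of_injective]
    · exact h0
    · exact IsLocalization.injective S m.primeCompl_le_nonZeroDivisors
  have hdvr : IsDiscreteValuationRing S := by
    -- A Noetherian local domain, not a field, is a DVR as soon as its maximal ideal is principal.
    refine ((IsDiscreteValuationRing.TFAE S hfield).out 0 4).2 ?_
    rw [hmax]
    obtain ⟨π, hπ⟩ := hp
    rw [hπ]
    exact ⟨algebraMap A S π, by
      rw [← Ideal.span, ← Ideal.span, Ideal.map_span, Set.image_singleton]⟩
  have hfrac : IsFractionRing S F := inferInstance
  let V : ValuationSubring F :=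
    { S.toSubring with
      mem_or_inv_mem' := fun x => by
        rcases ValuationRing.isInteger_or_isInteger S x with ⟨y, hy⟩ | ⟨y, hy⟩
        · exact Or.inl (hy ▸ y.2)
        · exact Or.inr (hy ▸ y.2) }
  have hdvrV : IsDiscreteValuationRing V := hdvr
  let R : Place K F := ⟨V, fun c => by
    rw [IsScalarTower.algebraMap_apply K A F]
    exact S.algebraMap_mem _, hdvrV⟩
  refine ⟨R, ?_, hS⟩
  let e : (A ⧸ m) ≃+* IsLocalRing.ResidueField R.valRing :=
    IsLocalization.AtPrime.equivQuotMaximalIdeal m S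
  refine Place.degree_eq_finrank_of_ringEquiv R e fun c => ?_
  have h1 : e (algebraMap K (A ⧸ m) c) = IsLocalRing.residue R.valRing
      ((algebraMap A S (algebraMap K A c) : S) : V) :=
    IsLocalization.AtPrime.equivQuotMaximalIdeal_apply_mk m S (algebraMap K A c)
  rw [h1]
  congr 1
  exact Subtype.ext (IsScalarTower.algebraMap_apply K A F c).symm

/-! ### Evaluation at affine points and regularity -/

section Evaluation

variable {K : Type*} [Field K] {E : WeierstrassCurve K} {L : Type*} [Field L] [Algebra K L]

instance isElliptic_baseChange [E.IsElliptic] : (E⁄L).toAffine.IsElliptic :=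
  inferInstanceAs (E.map _).IsElliptic

lemma aevalAeval_aeval (x : L) (l : K[X]) (g : K[X][Y]) :
    aevalAeval x (aeval x l) g = aeval x (g.eval l) := by
  induction g using Polynomial.induction_on' with
  | add f g hf hg => simp only [map_add, eval_add, hf, hg]
  | monomial n q =>
    rw [← C_mul_X_pow_eq_monomial]
    simp

lemma equation_iff_aevalAeval {x y : L} :
    (E⁄L).toAffine.Equation x y ↔ aevalAeval x y E.toAffine.polynomial = 0 := by
  rw [WeierstrassCurve.Affine.equation_iff']
  have : aevalAeval x y E.toAffine.polynomial =
      y ^ 2 + algebraMap K L E.a₁ * x * y + algebraMap K L E.a₃ * y -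
        (x ^ 3 + algebraMap K L E.a₂ * x ^ 2 + algebraMap K L E.a₄ * x + algebraMap K L E.a₆) := by
    simp [WeierstrassCurve.Affine.polynomial, add_mul, add_assoc]
  rw [this]
  rfl

/-- Evaluation of polynomial functions on `E` at an affine point. -/
noncomputable def evalPoint {x y : L} (h : (E⁄L).toAffine.Equation x y) :
    E.toAffine.CoordinateRing →ₐ[K] L :=
  Ideal.Quotient.liftₐ (Ideal.span {E.toAffine.polynomial}) (aevalAeval x y) fun _ ha =>
    aevalAeval_eq_zero_of_mk h (Ideal.Quotient.eq_zero_iff_mem.2 ha)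

lemma evalPoint_mk {x y : L} (h : (E⁄L).toAffine.Equation x y) (g : K[X][Y]) :
    evalPoint h (WeierstrassCurve.Affine.CoordinateRing.mk E.toAffine g) = aevalAeval x y g :=
  rfl

/-- Puts regularity in the form that describes the valuation ring in
`Place.exists_of_isPrincipal_maximal`, so that comparing a place with a point reduces to comparing
two ideals. -/
lemma isRegularAt_some_iff {x y : L} (h : (E⁄L).toAffine.Nonsingular x y)
    (f : E.toAffine.FunctionField) :
    IsRegularAt E (.some x y h) f ↔ ∃ a s : E.toAffine.CoordinateRing,
      s ∉ RingHom.ker (evalPoint h.1) ∧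
        f = algebraMap _ E.toAffine.FunctionField a / algebraMap _ E.toAffine.FunctionField s := by
  constructor
  · rintro ⟨a, b, hb, hf⟩
    exact ⟨_, _, hb, hf⟩
  · rintro ⟨a, s, hs, hf⟩
    obtain ⟨a, rfl⟩ := AdjoinRoot.mk_surjective a
    obtain ⟨s, rfl⟩ := AdjoinRoot.mk_surjective s
    exact ⟨a, s, hs, hf⟩

end Evaluation

/-! ### The place cut out by a line -/

section Line

open WeierstrassCurve.Affine (linePolynomial)

variable {K : Type*} [Field K] {E : WeierstrassCurve K} {L : Type*} [Field L] [Algebra K L]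
  {a b : K}

/-- The ideal of functions on `E` vanishing on the line `Y = aX + b`. -/
noncomputable def lineIdeal (E : WeierstrassCurve K) (a b : K) : Ideal E.toAffine.CoordinateRing :=
  Ideal.span {WeierstrassCurve.Affine.CoordinateRing.YClass E.toAffine (linePolynomial 0 b a)}

lemma equation_line_iff {x : L} :
    (E⁄L).toAffine.Equation x (aeval x (linePolynomial 0 b a)) ↔
      aeval x (E.toAffine.addPolynomial 0 b a) = 0 := by
  rw [equation_iff_aevalAeval, aevalAeval_aeval]
  rfl

lemma natDegree_addPolynomial (E : WeierstrassCurve K) (x y ℓ : K) :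
    (E.toAffine.addPolynomial x y ℓ).natDegree = 3 := by
  rw [WeierstrassCurve.Affine.addPolynomial_eq, natDegree_neg]
  exact Cubic.natDegree_of_a_ne_zero one_ne_zero

/-- Modulo `Y - l(X)`, a function `g` reduces to `g(X, l(X))`. If this vanishes at `x`, it is
divisible by the irreducible cubic, which in the coordinate ring is itself a multiple of `Y - l(X)`.
-/
lemma ker_evalPoint_eq_lineIdeal (hp : Irreducible (E.toAffine.addPolynomial 0 b a)) {x : L}
    (h : (E⁄L).toAffine.Equation x (aeval x (linePolynomial 0 b a))) :
    RingHom.ker (evalPoint h) = lineIdeal E a b := by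
  apply le_antisymm
  · intro r hr
    obtain ⟨g, rfl⟩ := AdjoinRoot.mk_surjective r
    have hg : aeval x (g.eval (linePolynomial 0 b a)) = 0 := by
      rw [← aevalAeval_aeval]; exact hr
    have hdvd : E.toAffine.addPolynomial 0 b a ∣ g.eval (linePolynomial 0 b a) := by
      have h1 := minpoly.dvd K x hg
      -- The minimal polynomial of `x` is the cubic up to a constant factor.
      rw [← minpoly.eq_of_irreducible hp (equation_line_iff.1 h)] at h1
      exact (dvd_mul_right _ _).trans h1
    rw [lineIdeal, Ideal.mem_span_singleton]
    have h2 : WeierstrassCurve.Affine.CoordinateRing.YClass E.toAffine (linePolynomial 0 b a) ∣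
        WeierstrassCurve.Affine.CoordinateRing.mk E.toAffine
          (C (g.eval (linePolynomial 0 b a))) := by
      refine dvd_trans ?_ (map_dvd (WeierstrassCurve.Affine.CoordinateRing.mk E.toAffine)
        (map_dvd C hdvd))
      rw [WeierstrassCurve.Affine.CoordinateRing.C_addPolynomial, map_mul]
      exact dvd_mul_right _ _
    have h3 : WeierstrassCurve.Affine.CoordinateRing.YClass E.toAffine (linePolynomial 0 b a) ∣
        WeierstrassCurve.Affine.CoordinateRing.mk E.toAffine
          (g - C (g.eval (linePolynomial 0 b a))) :=
      map_dvd (WeierstrassCurve.Affine.CoordinateRing.mk E.toAffine) X_sub_C_dvd_sub_C_eval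
    have h4 := dvd_add h3 h2
    rw [← map_add, sub_add_cancel] at h4
    exact h4
  · rw [lineIdeal, Ideal.span_singleton_le_iff_mem, RingHom.mem_ker]
    refine (evalPoint_mk h _).trans ?_
    simp

/-- If the line `Y = aX + b` meets `E` in an irreducible cubic, its ideal is maximal with residue
field of degree three. -/
lemma isMaximal_lineIdeal (hp : Irreducible (E.toAffine.addPolynomial 0 b a)) :
    (lineIdeal E a b).IsMaximal ∧
      Module.finrank K (E.toAffine.CoordinateRing ⧸ lineIdeal E a b) = 3 := by
  have : Fact (Irreducible (E.toAffine.addPolynomial 0 b a)) := ⟨hp⟩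
  -- The tautological intersection point, over the cubic field generated by its abscissa.
  let L := AdjoinRoot (E.toAffine.addPolynomial 0 b a)
  let x : L := AdjoinRoot.root _
  have h : (E⁄L).toAffine.Equation x (aeval x (linePolynomial 0 b a)) := by
    rw [equation_line_iff, AdjoinRoot.aeval_eq, AdjoinRoot.mk_self]
  have hsurj : Function.Surjective (evalPoint h) := by
    intro z
    obtain ⟨g, rfl⟩ := AdjoinRoot.mk_surjective z
    refine ⟨WeierstrassCurve.Affine.CoordinateRing.mk E.toAffine (C g), ?_⟩
    rw [evalPoint_mk, aevalAeval_C, AdjoinRoot.aeval_eq]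
  rw [← ker_evalPoint_eq_lineIdeal hp h]
  refine ⟨RingHom.ker_isMaximal_of_surjective _ hsurj, ?_⟩
  rw [(Ideal.quotientKerAlgEquivOfSurjective hsurj).toLinearEquiv.finrank_eq,
    (AdjoinRoot.powerBasis hp.ne_zero).finrank, AdjoinRoot.powerBasis_dim, natDegree_addPolynomial]

/-- A line that meets `E` in an irreducible cubic defines a place of degree three, whose geometric
points are the intersection points. -/
theorem exists_place_of_irreducible [E.IsElliptic]
    (hp : Irreducible (E.toAffine.addPolynomial 0 b a)) [IsAlgClosed L] :
    ∃ R : Place K E.toAffine.FunctionField, R.degree = 3 ∧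
      ∀ Q, Q ∈ R.points L ↔ ∃ x y h, Q = .some x y h ∧ y = aeval x (linePolynomial 0 b a) := by
  obtain ⟨hm, hfin⟩ := isMaximal_lineIdeal hp
  have hY := WeierstrassCurve.Affine.CoordinateRing.YClass_ne_zero (W' := E.toAffine)
    (linePolynomial 0 b a)
  have hnoeth : IsNoetherianRing E.toAffine.CoordinateRing :=
    inferInstanceAs (IsNoetherianRing (AdjoinRoot _))
  have hfinite : Module.Finite K[X] E.toAffine.CoordinateRing :=
    .of_basis (WeierstrassCurve.Affine.CoordinateRing.basis E.toAffine)
  obtain ⟨R, hdeg, hR⟩ := Place.exists_of_isPrincipal_maximal (K := K)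
    (F := E.toAffine.FunctionField) (lineIdeal E a b) ⟨_, rfl⟩ (by simpa [lineIdeal] using hY)
  have hmem : ∀ (x : L) (h), (.some x (aeval x (linePolynomial 0 b a)) h :
      (E⁄L).toAffine.Point) ∈ R.points L := fun x h f => by
    rw [hR, isRegularAt_some_iff, ker_evalPoint_eq_lineIdeal hp h.1]
  let ψ := polyFun E (Y - C (linePolynomial 0 b a))
  have hψ : ψ ≠ 0 := (map_ne_zero_iff _ (IsFractionRing.injective _ _)).2 hY
  -- `ψ⁻¹` has a pole at the points of the line but is regular at every other point, including
  -- infinity, so it excludes all of those from the place.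
  have hinv : ψ⁻¹ ∉ R.valRing := by
    obtain ⟨x, hx⟩ := IsAlgClosed.exists_aeval_eq_zero L (E.toAffine.addPolynomial 0 b a)
      (degree_pos_of_irreducible hp).ne'
    have hns := WeierstrassCurve.Affine.equation_iff_nonsingular.1 (equation_line_iff.2 hx)
    rw [hmem x hns, isRegularAt_inv_iff hns hψ]
    simp
  refine ⟨R, hdeg.trans hfin, ?_⟩
  rintro (_ | ⟨x, y, h⟩)
  · refine iff_of_false (fun hQ => hinv ((hQ _).2 ?_)) (by rintro ⟨x, y, h, hQ, -⟩; cases hQ)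
    -- At infinity, the norm of `1` has degree 0, and that of `ψ` is a nonzero polynomial.
    refine ⟨1, _, hY, ?_, ?_⟩
    · rw [map_one, degree_one, zero_le_degree_iff, Algebra.norm_ne_zero_iff]
      exact hY
    · rw [map_one, one_div]
      rfl
  · constructor
    · intro hQ
      refine ⟨x, y, h, rfl, ?_⟩
      by_contra hy
      refine hinv ((hQ _).2 ((isRegularAt_inv_iff h hψ).2 ?_))
      simpa [sub_eq_zero] using hy
    · rintro ⟨x', y', h', hQ, rfl⟩
      rw [hQ]
      exact hmem _ _

end Line

/-! ### Existence of the line over a finite field -/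

open WeierstrassCurve.Affine (linePolynomial)

open Finset in
/-- Over a finite field with at least five elements, some line meets a Weierstrass curve in an
irreducible cubic. -/
theorem exists_irreducible_addPolynomial {K : Type*} [Field K] [Finite K] (hq : 5 ≤ Nat.card K)
    (E : WeierstrassCurve K) : ∃ a b : K, Irreducible (E.toAffine.addPolynomial 0 b a) := by
  classical
  have := Fintype.ofFinite K
  rw [Nat.card_eq_fintype_card] at hq
  have hline : ∀ a b x : K, E.toAffine.Equation x (a * x + b) ↔
      (E.toAffine.addPolynomial 0 b a).IsRoot x := fun a b x => by
    rw [WeierstrassCurve.Affine.Equation, WeierstrassCurve.Affine.addPolynomial, IsRoot.def,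
      ← coe_evalRingHom, evalEval, linePolynomial]
    simp [WeierstrassCurve.Affine.polynomial]
  let S : Finset (K × K) := {P | E.toAffine.Equation P.1 P.2}
  have hv : ∀ x, #{P ∈ S | P.1 = x} ≤ 2 := by
    intro x
    let g : K[X] := X ^ 2 + C (E.a₁ * x + E.a₃) * X + C (-(x ^ 3 + E.a₂ * x ^ 2 + E.a₄ * x + E.a₆))
    have hg : g.natDegree = 2 := by simp only [g]; compute_degree!
    have hg0 : g ≠ 0 := fun h0 => by simp [h0] at hg
    have hinj : Set.InjOn Prod.snd (SetLike.coe {P ∈ S | P.1 = x}) := by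
      rintro ⟨u, v⟩ hu ⟨u', v'⟩ hu' rfl
      simp_all
    rw [← hg, ← card_image_of_injOn hinj]
    refine card_le_degree_of_subset_roots fun y hy => ?_
    simp only [S, image_val, Multiset.mem_dedup, Multiset.mem_map, mem_val, mem_filter, mem_univ,
      true_and, Prod.exists] at hy
    obtain ⟨_, y, ⟨hz, rfl⟩, rfl⟩ := hy
    rw [WeierstrassCurve.Affine.equation_iff'] at hz
    rw [mem_roots hg0, IsRoot.def]
    simp only [g, eval_add, eval_mul, eval_pow, eval_X, eval_C]
    linear_combination hz
  have hl : ∀ a b, #{P ∈ S | P.2 = a * P.1 + b} ≤ 3 := by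
    intro a b
    have hp := natDegree_addPolynomial E 0 b a
    have hp0 : E.toAffine.addPolynomial 0 b a ≠ 0 := fun h0 => by simp [h0] at hp
    have hinj : Set.InjOn Prod.fst (SetLike.coe {P ∈ S | P.2 = a * P.1 + b}) := by
      rintro ⟨u, v⟩ hu ⟨u', v'⟩ hu' rfl
      simp_all
    rw [← hp, ← card_image_of_injOn hinj]
    refine card_le_degree_of_subset_roots fun x hx => ?_
    simp only [S, image_val, Multiset.mem_dedup, Multiset.mem_map, mem_val, mem_filter, mem_univ,
      true_and, Prod.exists] at hx
    obtain ⟨x, y, ⟨hz, rfl⟩, rfl⟩ := hx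
    rw [mem_roots hp0]
    exact (hline a b x).1 hz
  obtain ⟨a, b, h⟩ := exists_line_disjoint hq S hv hl
  refine ⟨a, b, ?_⟩
  -- In degree 2 or 3, having no root is the same as being irreducible.
  rw [irreducible_iff_roots_eq_zero_of_degree_le_three (by rw [natDegree_addPolynomial]; simp)
    (natDegree_addPolynomial ..).le]
  refine Multiset.eq_zero_of_forall_notMem fun x hx => ?_
  exact h (x, a * x + b) (by simpa [S, hline] using isRoot_of_mem_roots hx) rfl

/-! ### The sum of the three intersection points -/

/-- Three points of a line with distinct `X`-coordinates sum to zero. -/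
lemma some_add_some_add_some_eq_zero {L : Type*} [Field L] [DecidableEq L]
    {W : WeierstrassCurve.Affine L} {a b x₁ x₂ x₃ y₁ y₂ y₃ : L}
    (h₁ : W.Nonsingular x₁ y₁) (h₂ : W.Nonsingular x₂ y₂) (h₃ : W.Nonsingular x₃ y₃)
    (e₁ : y₁ = a * x₁ + b) (e₂ : y₂ = a * x₂ + b) (e₃ : y₃ = a * x₃ + b)
    (h₁₂ : x₁ ≠ x₂) (h₁₃ : x₁ ≠ x₃) (h₂₃ : x₂ ≠ x₃) :
    WeierstrassCurve.Affine.Point.some x₁ y₁ h₁ + .some x₂ y₂ h₂ + .some x₃ y₃ h₃ = 0 := by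
  have hslope : W.slope x₁ x₂ y₁ y₂ = a := by
    rw [WeierstrassCurve.Affine.slope_of_X_ne h₁₂, div_eq_iff (sub_ne_zero.2 h₁₂)]
    linear_combination e₁ - e₂
  -- The roots of the cubic are `x₁`, `x₂` and the abscissa of the sum of the first two points; `x₃`
  -- is a root other than `x₁`, `x₂`.
  have hroot := congrArg (eval x₃)
    (WeierstrassCurve.Affine.addPolynomial_slope h₁.1 h₂.1 fun h => h₁₂ h.1)
  have hzero : eval x₃ (W.addPolynomial x₁ y₁ (W.slope x₁ x₂ y₁ y₂)) = 0 := by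
    rw [hslope, WeierstrassCurve.Affine.addPolynomial_eq]
    have := (WeierstrassCurve.Affine.equation_iff' x₃ y₃).1 h₃.1
    simp only [Cubic.toPoly, eval_neg, eval_add, eval_mul, eval_pow, eval_X, eval_C]
    subst e₁ e₃
    linear_combination this
  rw [hzero] at hroot
  have hx : W.addX x₁ x₂ (W.slope x₁ x₂ y₁ y₂) = x₃ := by
    simp only [eval_neg, eval_mul, eval_sub, eval_X, eval_C, zero_eq_neg, mul_eq_zero, sub_eq_zero,
      h₁₃.symm, h₂₃.symm, false_or] at hroot
    exact hroot.symm
  rw [WeierstrassCurve.Affine.Point.add_of_X_ne' h₁₂, neg_add_eq_zero]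
  have hy : W.negAddY x₁ x₂ y₁ (W.slope x₁ x₂ y₁ y₂) = y₃ := by
    rw [WeierstrassCurve.Affine.negAddY, hx, hslope]
    linear_combination e₁ - e₃
  congr 1

/-- Perfectness makes the irreducible cubic separable, so the place has three points with distinct
abscissas and each counts once in the divisor. -/
lemma sum_divisor_eq_zero {K : Type*} [Field K] [PerfectField K] {E : WeierstrassCurve K}
    [E.IsElliptic] {L : Type*} [Field L] [Algebra K L] [IsAlgClosure K L] {a b : K}
    (hp : Irreducible (E.toAffine.addPolynomial 0 b a)) (R : Place K E.toAffine.FunctionField)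
    (hR : ∀ Q, Q ∈ R.points L ↔
      ∃ x y h, Q = .some x y h ∧ y = aeval x (linePolynomial 0 b a)) :
    Divisor.sum (R.divisor L) = 0 := by
  classical
  have hclosed : IsAlgClosed L := IsAlgClosure.isAlgClosed K
  have hcard := card_rootSet_eq_natDegree (K := L) (PerfectField.separable_of_irreducible hp)
    (IsAlgClosed.splits _)
  rw [natDegree_addPolynomial, ← Set.toFinset_card,
    Finset.card_eq_three] at hcard
  obtain ⟨x₁, x₂, x₃, h₁₂, h₁₃, h₂₃, hx⟩ := hcard
  have hmem : ∀ x : L, x ∈ ({x₁, x₂, x₃} : Finset L) ↔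
      (E⁄L).toAffine.Nonsingular x (aeval x (linePolynomial 0 b a)) := fun x => by
    rw [← WeierstrassCurve.Affine.equation_iff_nonsingular, equation_line_iff, ← hx,
      Set.mem_toFinset, mem_rootSet, and_iff_right hp.ne_zero]
  have n₁ := (hmem x₁).1 (by simp)
  have n₂ := (hmem x₂).1 (by simp)
  have n₃ := (hmem x₃).1 (by simp)
  have hpts : (R.finite_points (L := L)).toFinset =
      {.some _ _ n₁, .some _ _ n₂, .some _ _ n₃} := by
    ext Q
    rw [Set.Finite.mem_toFinset, hR]
    simp only [Finset.mem_insert, Finset.mem_singleton]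
    constructor
    · rintro ⟨x, y, h, rfl, rfl⟩
      have := (hmem x).2 h
      simp only [Finset.mem_insert, Finset.mem_singleton] at this
      rcases this with rfl | rfl | rfl <;> simp
    · rintro (rfl | rfl | rfl)
      exacts [⟨_, _, n₁, rfl, rfl⟩, ⟨_, _, n₂, rfl, rfl⟩, ⟨_, _, n₃, rfl, rfl⟩]
  have hline : ∀ x : L, aeval x (linePolynomial 0 b a) = algebraMap K L a * x + algebraMap K L b :=
    fun x => by simp [linePolynomial]
  have hsum := some_add_some_add_some_eq_zero n₁ n₂ n₃ (hline x₁) (hline x₂) (hline x₃) h₁₂ h₁₃ h₂₃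
  rw [Divisor.sum, Place.divisor, hpts, Finset.sum_insert (by simp [h₁₂, h₁₃]),
    Finset.sum_insert (by simp [h₂₃]), Finset.sum_singleton,
    Finsupp.sum_add_index' (by simp) (fun _ _ _ => add_smul ..),
    Finsupp.sum_add_index' (by simp) (fun _ _ _ => add_smul ..)]
  simp only [Finsupp.sum_single_index, zero_smul, one_smul]
  rw [← add_assoc]
  convert hsum

end EllipticPlace

theorem mainTheorem12 {K : Type*} [Field K] [Finite K] (hq : 6 ≤ Nat.card K)
    (E : WeierstrassCurve K) [E.IsElliptic] (L : Type*) [Field L] [Algebra K L]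
    [IsAlgClosure K L] :
    ∃ R : EllipticPlace.Place K E.toAffine.FunctionField, R.degree = 3 ∧
      EllipticPlace.Divisor.sum (R.divisor L) = 0 := by
  have : IsAlgClosed L := IsAlgClosure.isAlgClosed K
  obtain ⟨a, b, hp⟩ :=
    EllipticPlace.exists_irreducible_addPolynomial ((Nat.le_succ 5).trans hq) E
  obtain ⟨R, hdeg, hR⟩ := EllipticPlace.exists_place_of_irreducible (L := L) hp
  exact ⟨R, hdeg, EllipticPlace.sum_divisor_eq_zero hp R hR⟩
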